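/- Let $m\ge 1$ be fixed. For each $n>m$ let $h_i$, $-m+2\le i\le n$, be i.i.d. $N(0,1)$ random variables and let $H$ be the $n\times m$ Toeplitz matrix $$H=\begin{bmatrix} h_{-m+2} & h_{-m+3} & \cdots & h_1\\ h_{-m+3} & h_{-m+4} & \cdots & h_2\\ \vdots & & & \vdots\\ h_{-m+n+1} & \cdots & \cdots & h_n\end{bmatrix},\qquad H_{ij}=h_{i+j-m}\quad(1\le i\le n,\ 1\le j\le m).$$ Let $y=Hx+e+w$, where $x\in\mathbb R^m$ is an arbitrary (possibly random, possibly $n$-dependent) state, $e\in\mathbb R^n$ is an outlier vector with almost surely at most $\beta n$ nonzero entries for a constant $\beta<1$, $w\in\mathbb R^n$ is an observation noise vector, and $e,w$ are deterministic or random with $e+w$ independent of $(h_i)_{-m+2\le i\le n}$. No independence or common distribution of the entries of $e$ or $w$ is assumed. An event depending on $n$ holds *with high probability* if its probability tends to $1$ as $n\to\infty$. Suppose that for every $t>0$ there is a constant $\alpha(t)>0$, not depending on $n$, such that with high probability at least $\alpha(t)\,n$ entries of $e+w$ have magnitude at most $t$. Then the problem $\min_{z\in\mathbb R^m}\|y-Hz\|_1$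 always has a solution, and its solutions converge to $x$ in probability: for every $\varepsilon>0$, with high probability every solution $\hat x$ satisfies $\|\hat x-x\|_2<\varepsilon$. -/

import Mathlib

open MeasureTheory ProbabilityTheory Filter Topology

/-- The `n × m` Toeplitz matrix of the problem: its first row is `h_{-m+2}, …, h_1`, its last row is
`h_{-m+n+1}, …, h_n`, and each row is the previous one with all indices increased by one.
Only `h_i` with `-m+2 ≤ i ≤ n` occur. Rows and columns are numbered from `0` here. -/
def toeplitzMatrix (m n : ℕ) (h : ℤ → ℝ) : Matrix (Fin n) (Fin m) ℝ :=
  Matrix.of fun i j => h (2 - (m : ℤ) + (i : ℕ) + (j : ℕ))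

/-- The observation `y = H x + e + w`. -/
def observation {m n : ℕ} (H : Matrix (Fin n) (Fin m) ℝ) (x : EuclideanSpace ℝ (Fin m))
    (e w : Fin n → ℝ) : Fin n → ℝ :=
  H.mulVec x.ofLp + e + w

/-- `xhat` is a solution of the minimization problem `min_z ‖y - H z‖₁`. -/
def IsL1Estimate {m n : ℕ} (H : Matrix (Fin n) (Fin m) ℝ) (y : Fin n → ℝ)
    (xhat : EuclideanSpace ℝ (Fin m)) : Prop :=
  ∀ z : EuclideanSpace ℝ (Fin m),
    ∑ i, |y i - H.mulVec xhat.ofLp i| ≤ ∑ i, |y i - H.mulVec z.ofLp i|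

/-- The number of nonzero entries of a vector. -/
noncomputable def numNonzero {n : ℕ} (v : Fin n → ℝ) : ℕ := {i : Fin n | v i ≠ 0}.ncard

/-- The number of entries of a vector of magnitude at most `t`. -/
noncomputable def numSmall {n : ℕ} (t : ℝ) (v : Fin n → ℝ) : ℕ := {i : Fin n | |v i| ≤ t}.ncard

/-- The events `E n` hold with high probability as `n → ∞`: the probability of the complement of
`E n` tends to `0` (for a set that is not measurable this is the outer measure of the complement,
so that `E n` contains measurable events whose probabilities tend to `1`). -/
def WithHighProbability {Ω : ℕ → Type*} [∀ n, MeasurableSpace (Ω n)]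
    (P : ∀ n, Measure (Ω n)) (E : ∀ n, Set (Ω n)) : Prop :=
  Tendsto (fun n => P n (E n)ᶜ) atTop (𝓝 0)

/-! Put `v = e + w` and `f d = ‖v - H d‖₁ - ‖v‖₁`. This is convex with `f 0 = 0`, and a solution
`xhat` satisfies `f (xhat - x) ≤ 0`. So if `f > 0` on the sphere of radius `ε`, every solution lies
within `ε` of `x` (`IsL1Estimate.norm_sub_lt`), whatever `x` is.

Fix `d` on the sphere and `v`. Each `(H d)_i` is Gaussian of variance `ε²`; let `κ` be its first
absolute moment. The mean of `|v i - (H d)_i| - |v i|` is nonnegative for every `v i`, and at least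
`κ - 2t` when `|v i| ≤ t`. With `t = κ/4` and `α n` small entries, the mean of `f d` is at least `2
α t n`. Rows at least `m` apart are independent, so the variance of `f d` is `O(n)`, and Chebyshev
gives `f d > α t n` up to probability `O(1/n)` (`measure_l1Excess_le_of_numSmall`). Independence of
`v` from the input allows `v` to be frozen.

With high probability `f` is Lipschitz with constant `K n`, by the column sums of `|H|`. A finite
net of mesh `α t / K`, independent of `n`, then covers the whole sphere. -/

/-! ### Convexity and Lipschitz bounds for the `ℓ¹` objective. -/

section Deterministic

variable {m n : ℕ}

/-- The increase `‖v - H d‖₁ - ‖v‖₁` of the `ℓ¹` objective when the true state is moved by `d`. -/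
noncomputable def l1Excess (H : Matrix (Fin n) (Fin m) ℝ) (v : Fin n → ℝ)
    (d : EuclideanSpace ℝ (Fin m)) : ℝ :=
  ∑ i, (|v i - H.mulVec d.ofLp i| - |v i|)

/-- The range of `H` is a finite-dimensional, hence closed, subspace of `ℓ¹`, so the distance from
`y` to it is attained. -/
theorem exists_isL1Estimate (H : Matrix (Fin n) (Fin m) ℝ) (y : Fin n → ℝ) :
    ∃ xhat, IsL1Estimate H y xhat := by
  let A : EuclideanSpace ℝ (Fin m) →ₗ[ℝ] PiLp 1 (fun _ : Fin n => ℝ) :=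
    (WithLp.linearEquiv 1 ℝ (Fin n → ℝ)).symm.toLinearMap ∘ₗ H.mulVecLin ∘ₗ
      (WithLp.linearEquiv 2 ℝ (Fin m → ℝ)).toLinearMap
  have : ProperSpace (PiLp 1 (fun _ : Fin n => ℝ)) := FiniteDimensional.proper ℝ _
  obtain ⟨_, ⟨xhat, rfl⟩, hx⟩ := (Submodule.closed_of_finiteDimensional
    (LinearMap.range A)).exists_infDist_eq_dist ⟨0, Submodule.zero_mem _⟩ (WithLp.toLp 1 y)
  have key : ∀ z, dist (WithLp.toLp 1 y) (A z) = ∑ i, |y i - H.mulVec z.ofLp i| := by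
    intro z
    rw [PiLp.dist_eq_sum (by simp)]
    simp [A, Real.dist_eq]
  refine ⟨xhat, fun z => ?_⟩
  rw [← key, ← key, ← hx]
  exact Metric.infDist_le_dist_of_mem ⟨z, rfl⟩

theorem residual_eq (H : Matrix (Fin n) (Fin m) ℝ) (x z : EuclideanSpace ℝ (Fin m))
    (e w : Fin n → ℝ) (i : Fin n) :
    observation H x e w i - H.mulVec z.ofLp i = (e + w) i - H.mulVec (z - x).ofLp i := by
  simp only [observation, WithLp.ofLp_sub, Matrix.mulVec_sub, Pi.add_apply, Pi.sub_apply]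
  ring

/-- Convexity along the segment from `0`, where the excess vanishes. -/
theorem l1Excess_smul_le (H : Matrix (Fin n) (Fin m) ℝ) (v : Fin n → ℝ)
    (d : EuclideanSpace ℝ (Fin m)) {s : ℝ} (hs0 : 0 ≤ s) (hs1 : s ≤ 1) :
    l1Excess H v (s • d) ≤ s * l1Excess H v d := by
  rw [l1Excess, l1Excess, Finset.mul_sum]
  refine Finset.sum_le_sum fun i _ => ?_
  simp only [WithLp.ofLp_smul, Matrix.mulVec_smul, Pi.smul_apply, smul_eq_mul]
  set g := H.mulVec d.ofLp i
  have h : |v i - s * g| ≤ |s * (v i - g)| + |(1 - s) * v i| := by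
    rw [show v i - s * g = s * (v i - g) + (1 - s) * v i by ring]
    exact abs_add_le _ _
  rw [abs_mul, abs_mul, abs_of_nonneg hs0, abs_of_nonneg (sub_nonneg.2 hs1)] at h
  linarith

/-- If `xhat - x` were outside the ball, shrinking it to the sphere would keep the excess
nonpositive by convexity. -/
theorem IsL1Estimate.norm_sub_lt {H : Matrix (Fin n) (Fin m) ℝ}
    {x xhat : EuclideanSpace ℝ (Fin m)} {e w : Fin n → ℝ}
    (hx : IsL1Estimate H (observation H x e w) xhat) {ε : ℝ} (hε : 0 < ε)
    (hpos : ∀ d : EuclideanSpace ℝ (Fin m), ‖d‖ = ε → 0 < l1Excess H (e + w) d) :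
    ‖xhat - x‖ < ε := by
  by_contra! hle
  have hd : 0 < ‖xhat - x‖ := hε.trans_le hle
  have h0 : l1Excess H (e + w) (xhat - x) ≤ 0 := by
    have := hx x
    simp only [residual_eq, sub_self, WithLp.ofLp_zero, Matrix.mulVec_zero, Pi.zero_apply,
      sub_zero] at this
    rw [l1Excess, Finset.sum_sub_distrib]
    linarith
  have h1 := l1Excess_smul_le H (e + w) (xhat - x) (s := ε / ‖xhat - x‖) (by positivity)
    ((div_le_one hd).2 hle)
  have h2 := hpos ((ε / ‖xhat - x‖) • (xhat - x)) (by
    rw [norm_smul, norm_div, norm_norm, Real.norm_of_nonneg hε.le, div_mul_cancel₀ _ hd.ne'])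
  have h3 : ε / ‖xhat - x‖ * l1Excess H (e + w) (xhat - x) ≤ 0 :=
    mul_nonpos_of_nonneg_of_nonpos (by positivity) h0
  linarith

theorem sum_abs_mulVec_le (H : Matrix (Fin n) (Fin m) ℝ) (d : EuclideanSpace ℝ (Fin m)) :
    ∑ i, |H.mulVec d.ofLp i| ≤ ‖d‖ * ∑ i, ∑ j, |H i j| := by
  rw [Finset.mul_sum]
  refine Finset.sum_le_sum fun i _ => ?_
  rw [Matrix.mulVec, dotProduct, Finset.mul_sum]
  refine (Finset.abs_sum_le_sum_abs _ _).trans (Finset.sum_le_sum fun j _ => ?_)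
  rw [abs_mul, mul_comm]
  exact mul_le_mul_of_nonneg_right (PiLp.norm_apply_le d j) (abs_nonneg _)

theorem l1Excess_sub_le (H : Matrix (Fin n) (Fin m) ℝ) (v : Fin n → ℝ)
    (d d' : EuclideanSpace ℝ (Fin m)) :
    l1Excess H v d' - l1Excess H v d ≤ ‖d - d'‖ * ∑ i, ∑ j, |H i j| := by
  refine le_trans ?_ (sum_abs_mulVec_le H (d - d'))
  rw [l1Excess, l1Excess, ← Finset.sum_sub_distrib]
  refine Finset.sum_le_sum fun i _ => ?_
  simp only [WithLp.ofLp_sub, Matrix.mulVec_sub, Pi.sub_apply]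
  have := abs_sub_abs_le_abs_sub (v i - H.mulVec d'.ofLp i) (v i - H.mulVec d.ofLp i)
  have h : v i - H.mulVec d'.ofLp i - (v i - H.mulVec d.ofLp i)
    = H.mulVec d.ofLp i - H.mulVec d'.ofLp i := by ring
  rw [h] at this
  linarith

/-- Lets the concentration bound for the excess also control the column sums of `|H|`. -/
theorem l1Excess_zero_single (H : Matrix (Fin n) (Fin m) ℝ) (j : Fin m) :
    l1Excess H 0 (EuclideanSpace.single j 1) = ∑ i, |H i j| := by
  simp [l1Excess]

end Deterministic

/-! ### Calculus of events that hold with high probability. -/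

section HighProbability

variable {Ω : ℕ → Type*} [∀ n, MeasurableSpace (Ω n)] {P : ∀ n, Measure (Ω n)}
  {E F : ∀ n, Set (Ω n)}

theorem WithHighProbability.mono (hE : WithHighProbability P E)
    (h : ∀ᶠ n in atTop, E n ⊆ F n) : WithHighProbability P F :=
  tendsto_of_tendsto_of_tendsto_of_le_of_le' tendsto_const_nhds hE
    (Eventually.of_forall fun _ => zero_le)
    (h.mono fun _ hn => measure_mono (Set.compl_subset_compl.2 hn))

theorem WithHighProbability.inter (hE : WithHighProbability P E)
    (hF : WithHighProbability P F) : WithHighProbability P fun n => E n ∩ F n := by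
  have := Tendsto.add hE hF
  rw [add_zero] at this
  refine tendsto_of_tendsto_of_tendsto_of_le_of_le tendsto_const_nhds this
    (fun _ => zero_le) fun n => ?_
  rw [Set.compl_inter]
  exact measure_union_le _ _

theorem WithHighProbability.biInter_finset {ι : Type*} (s : Finset ι) {G : ι → ∀ n, Set (Ω n)}
    (hG : ∀ i ∈ s, WithHighProbability P (G i)) :
    WithHighProbability P fun n => ⋂ i ∈ s, G i n := by
  have h := tendsto_finsetSum s hG
  rw [Finset.sum_const_zero] at h
  refine tendsto_of_tendsto_of_tendsto_of_le_of_le tendsto_const_nhds h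
    (fun _ => zero_le) fun n => ?_
  simp only [Set.compl_iInter]
  exact measure_biUnion_finset_le s _

theorem withHighProbability_of_le_div {C : ℝ}
    (h : ∀ᶠ n in atTop, P n (E n)ᶜ ≤ ENNReal.ofReal (C / n)) : WithHighProbability P E := by
  have := ENNReal.tendsto_ofReal (tendsto_const_div_atTop_nhds_zero_nat C)
  rw [ENNReal.ofReal_zero] at this
  exact tendsto_of_tendsto_of_tendsto_of_le_of_le' tendsto_const_nhds this
    (Eventually.of_forall fun _ => zero_le) h

end HighProbability

/-- Covariances vanish outside a band of fewer than `2m` indices per row when `m > 0`; inside it,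
`Var[Z i - Z j] ≥ 0` bounds them by `B`. -/
theorem variance_sum_le_of_dependence_range {Ω : Type*} [MeasurableSpace Ω] {P : Measure Ω}
    [IsProbabilityMeasure P] {n : ℕ} (m : ℕ) {Z : Fin n → Ω → ℝ} {B : ℝ}
    (hZ : ∀ i, MemLp (Z i) 2 P) (hB : ∀ i, Var[Z i; P] ≤ B)
    (hind : ∀ i j : Fin n, (i : ℕ) + m ≤ j → IndepFun (Z i) (Z j) P) :
    Var[fun ω => ∑ i, Z i ω; P] ≤ 2 * m * B * n := by
  have hcov : ∀ i j, cov[Z i, Z j; P] ≤ B := fun i j => by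
    have h1 := variance_nonneg (Z i - Z j) P
    rw [variance_sub (hZ i) (hZ j)] at h1
    linarith [hB i, hB j]
  have hrow : ∀ i, ∑ j, cov[Z i, Z j; P] ≤ 2 * m * B := fun i => by
    have hB0 : 0 ≤ B := (variance_nonneg (Z i) P).trans (hB i)
    have hcard : (Finset.univ.filter fun j : Fin n => (j : ℕ) < i + m ∧ (i : ℕ) < j + m).card
        ≤ 2 * m := by
      have := Finset.card_le_card_of_injOn (fun j : Fin n => (j : ℕ))
        (s := Finset.univ.filter fun j : Fin n => (j : ℕ) < i + m ∧ (i : ℕ) < j + m)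
        -- The subtraction truncates at `0`, which only shortens the interval.
        (t := Finset.Ico (i + 1 - m) (i + m)) (by intro j hj; simp at hj ⊢; omega)
        Fin.val_injective.injOn
      rw [Nat.card_Ico] at this
      omega
    calc ∑ j, cov[Z i, Z j; P]
        ≤ ∑ j : Fin n, if (j : ℕ) < i + m ∧ (i : ℕ) < j + m then B else 0 := by
          refine Finset.sum_le_sum fun j _ => ?_
          split_ifs with h
          · exact hcov i j
          · rw [not_and_or, not_lt, not_lt] at h
            rcases h with h | h
            · exact ((hind i j h).covariance_eq_zero (hZ i) (hZ j)).le
            · exact ((hind j i h).symm.covariance_eq_zero (hZ i) (hZ j)).le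
      _ ≤ 2 * m * B := by
          rw [← Finset.sum_filter, Finset.sum_const, nsmul_eq_mul]
          exact mul_le_mul_of_nonneg_right (by exact_mod_cast hcard) hB0
  rw [variance_fun_sum hZ]
  calc ∑ i, ∑ j, cov[Z i, Z j; P] ≤ ∑ _i : Fin n, 2 * m * B := Finset.sum_le_sum fun i _ => hrow i
    _ = 2 * m * B * n := by simp [mul_comm]

/-- Fubini on the product law: a bound uniform over frozen values `v` survives when `v` is replaced
by the independent `V`. -/
theorem IndepFun.measure_prodMk_mem_le {Ω α β : Type*} [MeasurableSpace Ω] [MeasurableSpace α]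
    [MeasurableSpace β] {P : Measure Ω} [IsProbabilityMeasure P] {Y : Ω → α} {V : Ω → β}
    (hYV : IndepFun Y V P) (hY : AEMeasurable Y P) (hV : AEMeasurable V P) {B : Set (α × β)}
    (hB : MeasurableSet B) {b : ENNReal} (hb : ∀ v, P {ω | (Y ω, v) ∈ B} ≤ b) :
    P {ω | (Y ω, V ω) ∈ B} ≤ b := by
  have := Measure.isProbabilityMeasure_map hY (μ := P)
  have := Measure.isProbabilityMeasure_map hV (μ := P)
  have h1 : P {ω | (Y ω, V ω) ∈ B} = P.map (fun ω => (Y ω, V ω)) B :=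
    (Measure.map_apply_of_aemeasurable (hY.prodMk hV) hB).symm
  rw [h1, hYV.map_prod_eq_prod_map_map hY hV, Measure.prod_apply_symm hB]
  refine (lintegral_mono (g := fun _ => b) fun v => ?_).trans (by simp)
  rw [Measure.map_apply_of_aemeasurable hY (measurable_prodMk_right hB)]
  exact hb v

/-! ### Independence and laws of the rows of the Toeplitz matrix. -/

section Toeplitz

theorem toeplitz_index_mem {m n : ℕ} (i : Fin n) (j : Fin m) :
    2 - (m : ℤ) + (i : ℕ) + (j : ℕ) ∈ Set.Icc (2 - (m : ℤ)) (n : ℤ) := by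
  have := i.2
  have := j.2
  constructor <;> omega

/-- The position in the input sequence of an entry of the Toeplitz matrix. -/
def toeplitzIndex {m n : ℕ} (i : Fin n) (j : Fin m) : Set.Icc (2 - (m : ℤ)) (n : ℤ) :=
  ⟨2 - (m : ℤ) + (i : ℕ) + (j : ℕ), toeplitz_index_mem i j⟩

theorem toeplitzIndex_injective {m n : ℕ} (i : Fin n) :
    Function.Injective (toeplitzIndex i : Fin m → _) := by
  intro j j' h
  simp only [toeplitzIndex, Subtype.mk.injEq] at h
  exact Fin.ext (by omega)

/-- The Toeplitz matrix as a function of the finitely many inputs that occur in it. -/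
def toeplitzOfInput {m n : ℕ} (a : Set.Icc (2 - (m : ℤ)) (n : ℤ) → ℝ) :
    Matrix (Fin n) (Fin m) ℝ :=
  Matrix.of fun i j => a (toeplitzIndex i j)

theorem toeplitzOfInput_mulVec {m n : ℕ} (a : Set.Icc (2 - (m : ℤ)) (n : ℤ) → ℝ)
    (u : Fin m → ℝ) (i : Fin n) :
    (toeplitzOfInput a).mulVec u i = ∑ j, a (toeplitzIndex i j) * u j := rfl

theorem measurable_numSmall {n : ℕ} (t : ℝ) :
    Measurable fun v : Fin n → ℝ => (numSmall t v : ℝ) := by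
  have h : (fun v : Fin n → ℝ => (numSmall t v : ℝ))
      = fun v => ∑ i, if |v i| ≤ t then (1 : ℝ) else 0 := by
    funext v
    rw [numSmall, Set.ncard_eq_toFinset_card', ← Finset.sum_filter]
    simp
  rw [h]
  refine Finset.measurable_sum _ fun i _ => Measurable.ite ?_ measurable_const measurable_const
  exact measurableSet_le (measurable_pi_apply i).abs measurable_const

theorem measurable_l1Excess {m n : ℕ} (d : EuclideanSpace ℝ (Fin m)) :
    Measurable fun p : (Set.Icc (2 - (m : ℤ)) (n : ℤ) → ℝ) × (Fin n → ℝ) =>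
      l1Excess (toeplitzOfInput p.1) p.2 d := by
  simp only [l1Excess, toeplitzOfInput_mulVec]
  fun_prop

variable {Ω : Type*} [MeasurableSpace Ω] {P : Measure Ω} {m n : ℕ}
  {X : Set.Icc (2 - (m : ℤ)) (n : ℤ) → Ω → ℝ}

theorem indepFun_toeplitz_rows (hlaw : ∀ k, HasLaw (X k) (gaussianReal 0 1) P)
    (hX : iIndepFun X P) {i i' : Fin n} (hii : (i : ℕ) + m ≤ i') :
    IndepFun (fun ω (j : Fin m) => X (toeplitzIndex i j) ω)
      (fun ω (j : Fin m) => X (toeplitzIndex i' j) ω) P := by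
  classical
  let S : Finset (Set.Icc (2 - (m : ℤ)) (n : ℤ)) := Finset.univ.image (toeplitzIndex i)
  let T : Finset (Set.Icc (2 - (m : ℤ)) (n : ℤ)) := Finset.univ.image (toeplitzIndex i')
  have hS : ∀ j, toeplitzIndex i j ∈ S := fun j => Finset.mem_image_of_mem _ (Finset.mem_univ j)
  have hT : ∀ j, toeplitzIndex i' j ∈ T := fun j => Finset.mem_image_of_mem _ (Finset.mem_univ j)
  -- Row `i` uses the `m` consecutive inputs starting at `2 - m + i`, so rows at least `m` apart
  -- share none.
  have hST : Disjoint S T := by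
    simp only [S, T, Finset.disjoint_left, Finset.mem_image, Finset.mem_univ, true_and,
      not_exists, forall_exists_index]
    rintro _ j rfl j' h
    simp only [toeplitzIndex, Subtype.mk.injEq] at h
    have := j.2
    omega
  have h := hX.indepFun_finset₀ S T hST fun k => (hlaw k).aemeasurable
  exact h.comp (φ := fun a j => a ⟨toeplitzIndex i j, hS j⟩)
    (ψ := fun a j => a ⟨toeplitzIndex i' j, hT j⟩) (by fun_prop) (by fun_prop)

theorem hasLaw_toeplitz_mulVec [IsProbabilityMeasure P]
    (hlaw : ∀ k, HasLaw (X k) (gaussianReal 0 1) P)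
    (hX : iIndepFun X P) (d : EuclideanSpace ℝ (Fin m)) (i : Fin n) :
    HasLaw (fun ω => (toeplitzOfInput fun k => X k ω).mulVec d.ofLp i)
      (gaussianReal 0 (‖d‖ ^ 2).toNNReal) P := by
  simp only [toeplitzOfInput_mulVec]
  have hl : ∀ j, HasLaw (fun ω => X (toeplitzIndex i j) ω * d j)
      (gaussianReal (d j * 0) (⟨d j ^ 2, sq_nonneg _⟩ * 1)) P := fun j =>
    gaussianReal_mul_const (hlaw _) _
  have hg : ∀ j, HasGaussianLaw (fun ω => X (toeplitzIndex i j) ω * d j) P := fun j =>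
    ⟨by rw [(hl j).map_eq]; infer_instance⟩
  have hI : iIndepFun (fun j ω => X (toeplitzIndex i j) ω * d j) P :=
    (hX.precomp (toeplitzIndex_injective i)).comp (fun j x => x * d j) (by fun_prop)
  have hs := hI.hasGaussianLaw_fun_sum hg
  refine ⟨hs.aemeasurable, ?_⟩
  rw [hs.map_eq_gaussianReal]
  congr 2
  · rw [integral_finsetSum _ fun j _ => (hg j).integrable]
    refine Finset.sum_eq_zero fun j _ => ?_
    rw [(hl j).integral_eq]
    simp
  · have hsum := IndepFun.variance_sum (s := Finset.univ) (fun j _ => (hg j).memLp_two)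
      fun j _ j' _ hj => hI.indepFun hj
    rw [show (fun ω => ∑ j, X (toeplitzIndex i j) ω * d j)
      = ∑ j, fun ω => X (toeplitzIndex i j) ω * d j by ext; simp, hsum,
      EuclideanSpace.norm_sq_eq]
    refine Finset.sum_congr rfl fun j _ => ?_
    rw [(hl j).variance_eq, variance_id_gaussianReal, Real.norm_eq_abs, sq_abs]
    exact mul_one (d j ^ 2)

end Toeplitz

/-! ### One Gaussian term `|a - g| - |a|`: variance and mean. -/

section Gaussian

/-- The first absolute moment of a centred Gaussian of variance `s`. -/
noncomputable def gaussianAbsMoment (s : NNReal) : ℝ := ∫ x, |x| ∂gaussianReal 0 s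

theorem gaussianAbsMoment_pos {s : NNReal} (hs : s ≠ 0) : 0 < gaussianAbsMoment s := by
  have := nullSingletonClass_gaussianReal (μ := 0) hs
  have hi : Integrable (fun x : ℝ => |x|) (gaussianReal 0 s) :=
    ((memLp_id_gaussianReal 1).integrable le_rfl).abs
  refine (integral_pos_iff_support_of_nonneg (fun x => abs_nonneg x) hi).2 ?_
  have h : Function.support (fun x : ℝ => |x|) = {0}ᶜ := by ext; simp
  rw [h, prob_compl_eq_one_sub (measurableSet_singleton 0), measure_singleton]
  simp

variable {Ω : Type*} [MeasurableSpace Ω] {P : Measure Ω}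
  {g : Ω → ℝ} {s : NNReal}

theorem memLp_two_of_hasLaw_gaussianReal (hg : HasLaw g (gaussianReal 0 s) P) :
    MemLp g 2 P :=
  HasGaussianLaw.memLp_two ⟨by rw [hg.map_eq]; infer_instance⟩

theorem integral_abs_of_hasLaw_gaussianReal (hg : HasLaw g (gaussianReal 0 s) P) :
    ∫ ω, |g ω| ∂P = gaussianAbsMoment s :=
  hg.integral_comp (f := fun x : ℝ => |x|) (by fun_prop)

theorem memLp_abs_sub_sub_abs [IsProbabilityMeasure P]
    (hg : MemLp g 2 P) (a : ℝ) :
    MemLp (fun ω => |a - g ω| - |a|) 2 P :=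
  ((memLp_const a).sub hg).abs.sub (memLp_const |a|)

theorem variance_abs_sub_sub_abs_le [IsProbabilityMeasure P]
    (hg : HasLaw g (gaussianReal 0 s) P) (a : ℝ) :
    Var[fun ω => |a - g ω| - |a|; P] ≤ s := by
  have hL := memLp_two_of_hasLaw_gaussianReal hg
  have hZ := memLp_abs_sub_sub_abs hL a
  have h0 : ∫ ω, g ω ∂P = 0 := by rw [hg.integral_eq]; simp
  have hv : Var[g; P] = s := by rw [hg.variance_eq]; simp
  rw [variance_of_integral_eq_zero hL.aemeasurable h0] at hv
  rw [← hv]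
  -- Since `||a - g| - |a|| ≤ |g|`, the bound does not depend on `a`, so arbitrarily large outliers
  -- do no harm.
  refine (variance_le_expectation_sq hZ.1).trans (integral_mono hZ.integrable_sq
    hL.integrable_sq fun ω => sq_le_sq.2 ?_)
  simpa using abs_abs_sub_abs_le (a - g ω) a

/-- Subgradient inequality: the integrand is at least `-sign(a) g`, which has mean zero. -/
theorem integral_abs_sub_sub_abs_nonneg [IsProbabilityMeasure P]
    (hg : HasLaw g (gaussianReal 0 s) P) (a : ℝ) :
    0 ≤ ∫ ω, (|a - g ω| - |a|) ∂P := by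
  have hL := memLp_two_of_hasLaw_gaussianReal hg
  have hi := hL.integrable one_le_two
  have h0 : ∫ ω, g ω ∂P = 0 := by rw [hg.integral_eq]; simp
  have hs : ∫ ω, -(SignType.sign a : ℝ) * g ω ∂P = 0 := by rw [integral_const_mul, h0, mul_zero]
  rw [← hs]
  refine integral_mono (hi.const_mul _)
    ((memLp_abs_sub_sub_abs hL a).integrable one_le_two) fun ω => ?_
  rcases lt_trichotomy a 0 with ha | rfl | ha
  · simp only [sign_neg ha, SignType.coe_neg, SignType.coe_one, abs_of_neg ha]
    linarith [neg_abs_le (a - g ω)]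
  · simp
  · simp only [sign_pos ha, SignType.coe_one, abs_of_pos ha]
    linarith [le_abs_self (a - g ω)]

/-- Pointwise, `|a - g| - |a| ≥ |g| - 2|a|`. -/
theorem le_integral_abs_sub_sub_abs [IsProbabilityMeasure P]
    (hg : HasLaw g (gaussianReal 0 s) P) {a t : ℝ}
    (ha : |a| ≤ t) : gaussianAbsMoment s - 2 * t ≤ ∫ ω, (|a - g ω| - |a|) ∂P := by
  have hL := memLp_two_of_hasLaw_gaussianReal hg
  have hi := (hL.integrable one_le_two).abs
  have h : ∫ ω, (|g ω| - 2 * t) ∂P = gaussianAbsMoment s - 2 * t := by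
    rw [integral_sub hi (integrable_const _), integral_abs_of_hasLaw_gaussianReal hg]
    simp
  rw [← h]
  refine integral_mono (hi.sub (integrable_const _))
    ((memLp_abs_sub_sub_abs hL a).integrable one_le_two) fun ω => ?_
  have := abs_sub_abs_le_abs_sub (g ω) a
  rw [abs_sub_comm] at this
  dsimp only
  linarith

end Gaussian

/-! ### Chebyshev bounds for the excess in a fixed direction. -/

section Concentration

variable {Ω : Type*} [MeasurableSpace Ω] {P : Measure Ω} [IsProbabilityMeasure P] {m n : ℕ}
  {X : Set.Icc (2 - (m : ℤ)) (n : ℤ) → Ω → ℝ}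

theorem measure_abs_l1Excess_sub_integral_ge_le
    (hlaw : ∀ k, HasLaw (X k) (gaussianReal 0 1) P) (hX : iIndepFun X P)
    (v : Fin n → ℝ) (d : EuclideanSpace ℝ (Fin m)) (hn : 0 < n) {c : ℝ} (hc : 0 < c) :
    P {ω | c * n ≤ |l1Excess (toeplitzOfInput fun k => X k ω) v d
        - ∫ ω, l1Excess (toeplitzOfInput fun k => X k ω) v d ∂P|}
      ≤ ENNReal.ofReal (2 * m * ‖d‖ ^ 2 / c ^ 2 / n) := by
  have hn' : (0 : ℝ) < n := by exact_mod_cast hn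
  have hg := hasLaw_toeplitz_mulVec hlaw hX d
  have hL : ∀ i, MemLp (fun ω => |v i - (toeplitzOfInput fun k => X k ω).mulVec d.ofLp i| - |v i|)
      2 P := fun i => memLp_abs_sub_sub_abs (memLp_two_of_hasLaw_gaussianReal (hg i)) (v i)
  have hvar := variance_sum_le_of_dependence_range m hL (B := ‖d‖ ^ 2)
    (fun i => (variance_abs_sub_sub_abs_le (hg i) (v i)).trans_eq
      (Real.coe_toNNReal _ (sq_nonneg _)))
    (fun i i' hii => by
      have := (indepFun_toeplitz_rows hlaw hX hii).comp
        (φ := fun a : Fin m → ℝ => |v i - ∑ j, a j * d j| - |v i|)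
        (ψ := fun a : Fin m → ℝ => |v i' - ∑ j, a j * d j| - |v i'|) (by fun_prop) (by fun_prop)
      exact this)
  refine (meas_ge_le_variance_div_sq (memLp_finsetSum Finset.univ fun i _ => hL i)
    (by positivity : 0 < c * n)).trans (ENNReal.ofReal_le_ofReal ?_)
  rw [div_div, div_le_div_iff₀ (by positivity) (by positivity)]
  calc _ ≤ (2 * m * ‖d‖ ^ 2 * n) * (c ^ 2 * n) := by gcongr
    _ = _ := by ring

theorem le_integral_l1Excess (hlaw : ∀ k, HasLaw (X k) (gaussianReal 0 1) P)
    (hX : iIndepFun X P) (v : Fin n → ℝ) (d : EuclideanSpace ℝ (Fin m)) (t : ℝ) :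
    numSmall t v * (gaussianAbsMoment (‖d‖ ^ 2).toNNReal - 2 * t)
      ≤ ∫ ω, l1Excess (toeplitzOfInput fun k => X k ω) v d ∂P := by
  have hg := hasLaw_toeplitz_mulVec hlaw hX d
  have hint : ∀ i, Integrable
      (fun ω => |v i - (toeplitzOfInput fun k => X k ω).mulVec d.ofLp i| - |v i|) P := fun i =>
    (memLp_abs_sub_sub_abs (memLp_two_of_hasLaw_gaussianReal (hg i)) (v i)).integrable one_le_two
  simp only [l1Excess]
  rw [integral_finsetSum _ fun i _ => hint i, numSmall, Set.ncard_eq_toFinset_card',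
    ← nsmul_eq_mul, ← Finset.sum_const]
  calc _ = ∑ i, if |v i| ≤ t then gaussianAbsMoment (‖d‖ ^ 2).toNNReal - 2 * t else 0 := by
        rw [← Finset.sum_filter]
        simp
    _ ≤ _ := Finset.sum_le_sum fun i _ => by
        split_ifs with h
        · exact le_integral_abs_sub_sub_abs (hg i) h
        · exact integral_abs_sub_sub_abs_nonneg (hg i) (v i)

theorem integral_l1Excess_zero (hlaw : ∀ k, HasLaw (X k) (gaussianReal 0 1) P)
    (hX : iIndepFun X P) (d : EuclideanSpace ℝ (Fin m)) :
    ∫ ω, l1Excess (toeplitzOfInput fun k => X k ω) 0 d ∂P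
      = n * gaussianAbsMoment (‖d‖ ^ 2).toNNReal := by
  have hg := hasLaw_toeplitz_mulVec hlaw hX d
  simp only [l1Excess, Pi.zero_apply, zero_sub, abs_neg, abs_zero, sub_zero]
  rw [integral_finsetSum _ fun i _ =>
    ((memLp_two_of_hasLaw_gaussianReal (hg i)).integrable one_le_two).abs]
  simp [integral_abs_of_hasLaw_gaussianReal (hg _)]

theorem measure_toeplitz_column_sum_gt_le (hlaw : ∀ k, HasLaw (X k) (gaussianReal 0 1) P)
    (hX : iIndepFun X P) (hn : 0 < n) (j : Fin m) :
    P {ω | ∑ i, |toeplitzOfInput (fun k => X k ω) i j| ≤ (gaussianAbsMoment 1 + 1) * n}ᶜ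
      ≤ ENNReal.ofReal (2 * m / n) := by
  -- A column sum has mean `n * gaussianAbsMoment 1`; the `+ 1` in the bound is the allowed
  -- deviation `c = 1`.
  have h := measure_abs_l1Excess_sub_integral_ge_le hlaw hX 0 (EuclideanSpace.single j 1) hn
    one_pos
  rw [integral_l1Excess_zero hlaw hX] at h
  simp only [l1Excess_zero_single, PiLp.norm_single, norm_one, one_pow,
    Real.toNNReal_one, mul_one, div_one] at h
  refine (measure_mono fun ω hω => ?_).trans h
  simp only [Set.mem_compl_iff, Set.mem_ofPred_eq, not_le] at hω ⊢
  refine le_trans ?_ (le_abs_self _)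
  linarith

/-- With `4t` the absolute moment, `a n` small entries give mean at least `2 a t n`, so an excess of
at most `a t n` is a deviation of at least `a t n`. The event is an implication so that, for frozen
`v` with too few small entries, the bad event is empty and the bound is uniform in `v`. -/
theorem measure_l1Excess_le_of_numSmall {V : Ω → Fin n → ℝ}
    (hlaw : ∀ k, HasLaw (X k) (gaussianReal 0 1) P) (hX : iIndepFun X P)
    (hV : AEMeasurable V P) (hind : IndepFun (fun ω k => X k ω) V P)
    (d : EuclideanSpace ℝ (Fin m)) (hd : d ≠ 0) (hn : 0 < n) {t a : ℝ} (ha : 0 < a)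
    (ht : 4 * t = gaussianAbsMoment (‖d‖ ^ 2).toNNReal) :
    P {ω | a * n ≤ numSmall t (V ω) →
        a * t * n < l1Excess (toeplitzOfInput fun k => X k ω) (V ω) d}ᶜ
      ≤ ENNReal.ofReal (2 * m * ‖d‖ ^ 2 / (a * t) ^ 2 / n) := by
  have hκ : 0 < gaussianAbsMoment (‖d‖ ^ 2).toNNReal :=
    gaussianAbsMoment_pos (by simpa using hd)
  have ht0 : 0 < t := by linarith
  let B : Set ((Set.Icc (2 - (m : ℤ)) (n : ℤ) → ℝ) × (Fin n → ℝ)) :=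
    {p | a * n ≤ numSmall t p.2} ∩ {p | l1Excess (toeplitzOfInput p.1) p.2 d ≤ a * t * n}
  have hB : MeasurableSet B :=
    (measurableSet_le measurable_const ((measurable_numSmall t).comp measurable_snd)).inter
      (measurableSet_le (measurable_l1Excess d) measurable_const)
  have hset : {ω | a * n ≤ numSmall t (V ω) →
      a * t * n < l1Excess (toeplitzOfInput fun k => X k ω) (V ω) d}ᶜ
      = {ω | ((fun k => X k ω), V ω) ∈ B} := by
    ext ω
    simp [B]
  rw [hset]
  refine IndepFun.measure_prodMk_mem_le hind
    (aemeasurable_pi_lambda _ fun k => (hlaw k).aemeasurable) hV hB fun v => ?_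
  by_cases hv : a * n ≤ numSmall t v
  · refine (measure_mono fun ω hω => ?_).trans
      (measure_abs_l1Excess_sub_integral_ge_le hlaw hX v d hn (mul_pos ha ht0))
    have hS : l1Excess (toeplitzOfInput fun k => X k ω) v d ≤ a * t * n := hω.2
    have hm := le_integral_l1Excess hlaw hX v d t
    have h2 : a * n * (2 * t)
        ≤ numSmall t v * (gaussianAbsMoment (‖d‖ ^ 2).toNNReal - 2 * t) := by
      rw [← ht]
      exact mul_le_mul hv (by linarith) (by positivity) (by positivity)
    rw [Set.mem_ofPred_eq, abs_sub_comm]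
    refine le_trans ?_ (le_abs_self _)
    linarith
  · simp [B, hv]

end Concentration

theorem theorem4 (m : ℕ) (hm : 0 < m)
    -- for each `n`, the probability space that carries the `n`-th problem
    {Ω : ℕ → Type*} [∀ n, MeasurableSpace (Ω n)]
    (P : ∀ n, Measure (Ω n)) [∀ n, IsProbabilityMeasure (P n)]
    -- the input `h_i`, the unknown state `x`, the outliers `e` and the observation noise `w`
    (h : ∀ n, ℤ → Ω n → ℝ)
    (x : ∀ n, Ω n → EuclideanSpace ℝ (Fin m))
    (e w : ∀ n, Ω n → Fin n → ℝ)
    -- `h_i`, `-m+2 ≤ i ≤ n`, are i.i.d. standard Gaussian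
    (hlaw : ∀ n, m < n → ∀ i ∈ Set.Icc (2 - (m : ℤ)) (n : ℤ),
      HasLaw (h n i) (gaussianReal 0 1) (P n))
    (hiid : ∀ n, m < n →
      iIndepFun (fun (i : Set.Icc (2 - (m : ℤ)) (n : ℤ)) => h n i) (P n))
    -- the total disturbance `e + w` is independent of the input
    (he : ∀ n, m < n → AEMeasurable (e n) (P n))
    (hw : ∀ n, m < n → AEMeasurable (w n) (P n))
    (hindep : ∀ n, m < n →
      IndepFun (fun ω (i : Set.Icc (2 - (m : ℤ)) (n : ℤ)) => h n i ω)
        (fun ω => e n ω + w n ω) (P n))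
    -- `e` has at most `β n` nonzero entries
    (β : ℝ) (hβ : β < 1)
    (hsparse : ∀ n, m < n → ∀ᵐ ω ∂(P n), (numNonzero (e n ω) : ℝ) ≤ β * n)
    -- with high probability at least `α(t) n` entries of `e + w` have magnitude at most `t`
    (α : ℝ → ℝ) (hα : ∀ t, 0 < t → 0 < α t)
    (hsmall : ∀ t, 0 < t →
      WithHighProbability P fun n => {ω | α t * n ≤ (numSmall t (e n ω + w n ω) : ℝ)}) :
    (∀ n (ω : Ω n), ∃ xhat, IsL1Estimate (toeplitzMatrix m n fun i => h n i ω)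
        (observation (toeplitzMatrix m n fun i => h n i ω) (x n ω) (e n ω) (w n ω)) xhat) ∧
    ∀ ε, 0 < ε →
      WithHighProbability P fun n => {ω | ∀ xhat,
        IsL1Estimate (toeplitzMatrix m n fun i => h n i ω)
          (observation (toeplitzMatrix m n fun i => h n i ω) (x n ω) (e n ω) (w n ω)) xhat →
        ‖xhat - x n ω‖ < ε} := by
  refine ⟨fun n ω => exists_isL1Estimate _ _, fun ε hε => ?_⟩
  set t := gaussianAbsMoment (ε ^ 2).toNNReal / 4 with ht
  have ht0 : 0 < t :=
    div_pos (gaussianAbsMoment_pos (Real.toNNReal_pos.2 (by positivity)).ne') (by norm_num)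
  have ha := hα t ht0
  set K := m * (gaussianAbsMoment 1 + 1) with hK
  have hK0 : 0 < K :=
    mul_pos (by exact_mod_cast hm) (by linarith [gaussianAbsMoment_pos one_ne_zero])
  -- The mesh `α t * t / K` makes the Lipschitz error at most the margin `α t * t * n`. It does not
  -- depend on `n`, so the union bound runs over a fixed finite set.
  obtain ⟨N, hNsub, hNfin, hNcov⟩ :=
    (isCompact_sphere (0 : EuclideanSpace ℝ (Fin m)) ε).finite_cover_balls
      (div_pos (mul_pos ha ht0) hK0)
  have hlaw' : ∀ n, m < n → ∀ k : Set.Icc (2 - (m : ℤ)) (n : ℤ),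
      HasLaw (h n k) (gaussianReal 0 1) (P n) := fun n hn k => hlaw n hn k k.2
  have hnet : WithHighProbability P fun n => ⋂ d ∈ hNfin.toFinset,
      {ω | α t * n ≤ numSmall t (e n ω + w n ω) →
        α t * t * n < l1Excess (toeplitzMatrix m n fun i => h n i ω) (e n ω + w n ω) d} := by
    refine WithHighProbability.biInter_finset _ fun d hd => ?_
    have hdε : ‖d‖ = ε := by simpa using hNsub (hNfin.mem_toFinset.1 hd)
    refine withHighProbability_of_le_div (C := 2 * m * ‖d‖ ^ 2 / (α t * t) ^ 2) ?_
    filter_upwards [eventually_gt_atTop m] with n hn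
    exact measure_l1Excess_le_of_numSmall (hlaw' n hn) (hiid n hn) ((he n hn).add (hw n hn))
      (hindep n hn) d (norm_pos_iff.1 (by linarith)) (by omega) ha (by rw [ht, hdε]; ring)
  have hcol : WithHighProbability P fun n => ⋂ j ∈ (Finset.univ : Finset (Fin m)),
      {ω | ∑ i, |toeplitzMatrix m n (fun i => h n i ω) i j|
        ≤ (gaussianAbsMoment 1 + 1) * n} := by
    refine WithHighProbability.biInter_finset _ fun j _ =>
      withHighProbability_of_le_div (C := 2 * m) ?_
    filter_upwards [eventually_gt_atTop m] with n hn
    exact measure_toeplitz_column_sum_gt_le (hlaw' n hn) (hiid n hn) (by omega) j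
  refine ((hnet.inter hcol).inter (hsmall t ht0)).mono (Eventually.of_forall fun n ω hω => ?_)
  obtain ⟨⟨hω1, hω2⟩, hω3⟩ := hω
  simp only [Set.mem_iInter, Set.Finite.mem_toFinset] at hω1 hω2
  intro xhat hx
  refine hx.norm_sub_lt hε fun d hd => ?_
  obtain ⟨d', hd', hdd⟩ : ∃ d' ∈ N, dist d d' < α t * t / K := by
    simpa using hNcov (mem_sphere_zero_iff_norm.2 hd)
  have hsum : ∑ i, ∑ j, |toeplitzMatrix m n (fun i => h n i ω) i j| ≤ K * n := by
    rw [Finset.sum_comm]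
    refine (Finset.sum_le_sum fun j hj => hω2 j hj).trans_eq ?_
    simp [hK, mul_assoc]
  have h1 := l1Excess_sub_le (toeplitzMatrix m n fun i => h n i ω) (e n ω + w n ω) d d'
  have h2 := hω1 d' hd' hω3
  have h3 : ‖d - d'‖ * ∑ i, ∑ j, |toeplitzMatrix m n (fun i => h n i ω) i j|
      ≤ α t * t / K * (K * n) := by
    rw [← dist_eq_norm]
    gcongr
  have h4 : α t * t / K * (K * n) = α t * t * n := by field_simp
  -- The excess at the net point `d'` exceeds `α t * t * n` strictly, and passing to `d` loses at
  -- most that much.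
  linarith
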